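/- Let $\mathcal H=\mathbb C^n$, $n\ge 1$, let $\beta>0$, and let $H_0,H_\tau$ be Hermitian operators on $\mathcal H$. For $i\in\{0,\tau\}$ put $F_i=-\beta^{-1}\ln\operatorname{Tr}e^{-\beta H_i}$ and $\Gamma_i=e^{\beta(F_i-H_i)}$. Let $\Phi$ be a positive trace-preserving linear map on the operators on $\mathcal H$ (for example, any completely positive trace-preserving map), let $\Phi^\dagger$ be its trace-dual, $\operatorname{Tr}[\Phi(X)Y]=\operatorname{Tr}[X\,\Phi^\dagger(Y)]$ for all $X,Y$, and put $$\rho_0=\Gamma_0,\qquad \Delta E=\operatorname{Tr}[\Phi(\rho_0)H_\tau]-\operatorname{Tr}[\rho_0H_0],\qquad \Delta F=F_\tau-F_0,\qquad \gamma=\frac{\Phi^\dagger(\Gamma_\tau)}{\operatorname{Tr}\Phi^\dagger(\Gamma_\tau)},$$ $\mathsf F(\rho,\sigma)=\|\sqrt\rho\sqrt\sigma\|_1=\operatorname{Tr}|\sqrt\rho\sqrt\sigma|$ and $\mathcal L(\rho,\sigma)=\arccos\mathsf F(\rho,\sigma)$. Then $\operatorname{Tr}\Phi^\dagger(\Gamma_\tau)>0$,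 $\mathsf F(\Gamma_0,\gamma)>0$, and $$\beta(\Delta E-\Delta F)\;\ge\;-2\ln\mathsf F(\Gamma_0,\gamma)-\ln\operatorname{Tr}\Phi^\dagger(\Gamma_\tau).$$ Moreover this bound is tighter than the one in terms of the Bures angle: $$-2\ln\mathsf F(\Gamma_0,\gamma)-\ln\operatorname{Tr}\Phi^\dagger(\Gamma_\tau)\;\ge\;\frac{8}{\pi^2}\mathcal L^2(\Gamma_0,\gamma)-\ln\operatorname{Tr}\Phi^\dagger(\Gamma_\tau),$$ and the latter inequality is strict whenever $\gamma\ne\Gamma_0$. -/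

import Mathlib

open scoped MatrixOrder

/-! Everything takes place on the finite-dimensional Hilbert space `ℂⁿ`; operators on it are the
matrices in `Matrix n n ℂ`, and `A ≤ B` is the Loewner order (`B - A` is positive semidefinite). -/

noncomputable section

namespace ThermoReverse

variable {n : Type*} [Fintype n] [DecidableEq n]

/-- The equilibrium free energy `F = -β⁻¹ ln Tr exp(-β H)` of the Hamiltonian `H` at inverse
temperature `β`. -/
def freeEnergy (β : ℝ) (H : Matrix n n ℂ) : ℝ :=
  -β⁻¹ * Real.log (Matrix.trace (NormedSpace.exp (-(β : ℂ) • H))).re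

/-- The thermal equilibrium (Gibbs) state `Γ = exp[β (F - H)]`. -/
def gibbs (β : ℝ) (H : Matrix n n ℂ) : Matrix n n ℂ :=
  NormedSpace.exp ((β : ℂ) • (((freeEnergy β H : ℝ) : ℂ) • (1 : Matrix n n ℂ) - H))

/-- The linear map `Φ` is trace preserving. -/
def IsTracePreserving (Φ : Matrix n n ℂ →ₗ[ℂ] Matrix n n ℂ) : Prop :=
  ∀ X : Matrix n n ℂ, (Φ X).trace = X.trace

/-- The trace-dual `Φ†` of `Φ`, given by its matrix entries `Φ†(Y) i j = Tr[Φ(|j⟩⟨i|) Y]`. It is the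
unique map with `Tr[Φ(X) Y] = Tr[X Φ†(Y)]`, see `trace_mul_traceDual` and `eq_traceDual`. -/
def traceDual (Φ : Matrix n n ℂ →ₗ[ℂ] Matrix n n ℂ) : Matrix n n ℂ →ₗ[ℂ] Matrix n n ℂ where
  toFun Y := Matrix.of fun i j => (Φ (Matrix.single j i 1) * Y).trace
  map_add' Y Z := by
    ext i j
    simp [mul_add]
  map_smul' c Y := by
    ext i j
    simp

theorem trace_mul_traceDual (Φ : Matrix n n ℂ →ₗ[ℂ] Matrix n n ℂ) (X Y : Matrix n n ℂ) :
    (Φ X * Y).trace = (X * traceDual Φ Y).trace := by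
  conv_lhs => rw [Matrix.matrix_eq_sum_single X]
  simp only [map_sum, Finset.sum_mul, Matrix.trace_sum]
  rw [Matrix.trace]
  simp only [Matrix.diag_apply, Matrix.mul_apply]
  refine Finset.sum_congr rfl fun i _ => Finset.sum_congr rfl fun j _ => ?_
  have h : Matrix.single i j (X i j) = X i j • Matrix.single i j (1 : ℂ) := by
    rw [Matrix.smul_single, smul_eq_mul, mul_one]
  rw [h, map_smul, Matrix.smul_mul, Matrix.trace_smul, smul_eq_mul]
  rfl

theorem eq_traceDual (Φ Ψ : Matrix n n ℂ →ₗ[ℂ] Matrix n n ℂ)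
    (h : ∀ X Y : Matrix n n ℂ, (Φ X * Y).trace = (X * Ψ Y).trace) : Ψ = traceDual Φ := by
  refine LinearMap.ext fun Y => Matrix.ext_iff_trace_mul_left.mpr fun X => ?_
  rw [← h, trace_mul_traceDual]

/-- The change of average internal energy, `ΔE = Tr[Φ(ρ₀) H_τ] - Tr[ρ₀ H₀]`. -/
def energyChange (Φ : Matrix n n ℂ →ₗ[ℂ] Matrix n n ℂ) (ρ₀ H₀ Hτ : Matrix n n ℂ) : ℝ :=
  (Φ ρ₀ * Hτ).trace.re - (ρ₀ * H₀).trace.re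

/-- The trace norm `‖A‖₁ = Tr |A|`, where `|A| = √(A* A)`. -/
def traceNorm (A : Matrix n n ℂ) : ℝ := (CFC.abs A).trace.re

/-- The fidelity `F(ρ, σ) = ‖√ρ √σ‖₁`. -/
def fidelity (ρ σ : Matrix n n ℂ) : ℝ := traceNorm (CFC.sqrt ρ * CFC.sqrt σ)

/-- The Bures angle `arccos F(ρ, σ)`. -/
def buresAngle (ρ σ : Matrix n n ℂ) : ℝ := Real.arccos (fidelity ρ σ)

/-- The number `Tr Φ†(Γ_τ)`. -/
def dualTrace (β : ℝ) (Φ : Matrix n n ℂ →ₗ[ℂ] Matrix n n ℂ) (Hτ : Matrix n n ℂ) : ℝ :=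
  (traceDual Φ (gibbs β Hτ)).trace.re

/-- The retrodicted state `γ = Φ†(Γ_τ) / Tr Φ†(Γ_τ)`. -/
def retrodicted (β : ℝ) (Φ : Matrix n n ℂ →ₗ[ℂ] Matrix n n ℂ) (Hτ : Matrix n n ℂ) :
    Matrix n n ℂ :=
  (traceDual Φ (gibbs β Hτ)).trace⁻¹ • traceDual Φ (gibbs β Hτ)

section CompletelyPositive

open scoped Matrix.Norms.L2Operator CStarAlgebra

/-- Every completely positive map is a positive linear map. So a statement about all positive linear
maps that preserve the trace covers all CPTP maps. -/
def ofCompletelyPositive (Φ : Matrix n n ℂ →CP Matrix n n ℂ) :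
    Matrix n n ℂ →ₚ[ℂ] Matrix n n ℂ :=
  PositiveLinearMap.ofClass Φ

theorem ofCompletelyPositive_apply (Φ : Matrix n n ℂ →CP Matrix n n ℂ) (X : Matrix n n ℂ) :
    ofCompletelyPositive Φ X = Φ X := rfl

end CompletelyPositive

end ThermoReverse

end

namespace ThermoReverse

section

open Matrix
open scoped ComplexOrder

/-! Write `Γ₀ = e^L`, `Γ_τ = e^K`, `N = Φ†`, `c = Tr N(e^K)`. Trace preservation of `Φ` makes `N`
unital, positivity of `Φ` makes `N` positive, and β(ΔE - ΔF) = Tr e^L L - Tr e^L N(K)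
(`mul_energyChange_sub`). Jensen's inequality for the joint spectral weights of `L` and `K` gives
exp(½ Tr e^L (N(K) - L)) ≤ Tr e^{L/2} N(e^{K/2}) (`exp_half_le_re_trace`). Kadison's inequality
N(e^{K/2})² ≤ N(e^K) and operator monotonicity of the square root give N(e^{K/2}) ≤ √c √γ. Since Tr
√Γ₀√γ is at most the fidelity, taking logarithms yields the bound. The comparison with the Bures
angle is scalar: cos x ≤ e^{-x²/2} says arccos² F ≤ -2 ln F, and 8/π² < 1. This last inequality is
strict, so strictness only needs a nonzero angle, i.e. F < 1, which holds when the states differ. -/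

/-! ### Scalar inequalities for the angle -/

theorem cos_le_exp_neg_sq_div_two {x : ℝ} (h0 : 0 ≤ x) (h1 : x ≤ Real.pi / 2) :
    Real.cos x ≤ Real.exp (-(x ^ 2 / 2)) := by
  have hd (y : ℝ) : HasDerivAt (fun y => Real.cos y * Real.exp (y ^ 2 / 2))
      (-Real.sin y * Real.exp (y ^ 2 / 2) + Real.cos y * (Real.exp (y ^ 2 / 2) * y)) y := by
    refine (Real.hasDerivAt_cos y).mul ?_
    have h : HasDerivAt (fun y : ℝ => y ^ 2 / 2) y y := by
      have := (hasDerivAt_pow 2 y).div_const 2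
      simpa using this
    exact h.exp
  have hanti : AntitoneOn (fun y => Real.cos y * Real.exp (y ^ 2 / 2))
      (Set.Icc 0 (Real.pi / 2)) := by
    refine antitoneOn_of_deriv_nonpos (convex_Icc _ _)
      (fun y _ => (hd y).continuousAt.continuousWithinAt)
      (fun y _ => (hd y).differentiableAt.differentiableWithinAt) fun y hy => ?_
    rw [interior_Icc] at hy
    rw [(hd y).deriv]
    have hc : 0 < Real.cos y := Real.cos_pos_of_mem_Ioo ⟨by linarith [hy.1, Real.pi_pos], hy.2⟩
    -- The derivative is e^{y²/2} (y cos y - sin y), negative because y < tan y.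
    have ht := Real.lt_tan hy.1 hy.2
    rw [Real.tan_eq_sin_div_cos, lt_div_iff₀ hc] at ht
    nlinarith [Real.exp_pos (y ^ 2 / 2)]
  have h := hanti ⟨le_rfl, h0.trans h1⟩ ⟨h0, h1⟩ h0
  simp only [Real.cos_zero, one_mul, zero_pow two_ne_zero, zero_div, Real.exp_zero] at h
  rw [Real.exp_neg, ← one_div, le_div_iff₀ (Real.exp_pos _)]
  exact h

theorem arccos_sq_le_neg_two_mul_log {F : ℝ} (h0 : 0 < F) (h1 : F ≤ 1) :
    Real.arccos F ^ 2 ≤ -2 * Real.log F := by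
  have h := cos_le_exp_neg_sq_div_two (Real.arccos_nonneg F) (Real.arccos_le_pi_div_two.2 h0.le)
  rw [Real.cos_arccos (by linarith) h1] at h
  have := (Real.log_le_iff_le_exp h0).2 h
  linarith

theorem eight_div_pi_sq_lt_one : 8 / Real.pi ^ 2 < 1 := by
  rw [div_lt_one (by positivity)]
  nlinarith [Real.pi_gt_three]

variable {n : Type*} [Fintype n] [DecidableEq n]

/-! ### Positivity, spectral decomposition and exponentials -/

theorem trace_mul_nonneg {A B : Matrix n n ℂ} (hA : A.PosSemidef) (hB : B.PosSemidef) :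
    0 ≤ (A * B).trace := by
  obtain ⟨C, rfl⟩ := CStarAlgebra.nonneg_iff_eq_star_mul_self.mp hB.nonneg
  rw [star_eq_conjTranspose, ← mul_assoc, trace_mul_comm, ← mul_assoc]
  exact (hA.mul_mul_conjTranspose_same C).trace_nonneg

theorem re_trace_mul_nonneg {A B : Matrix n n ℂ} (hA : A.PosSemidef) (hB : B.PosSemidef) :
    0 ≤ (A * B).trace.re :=
  (Complex.nonneg_iff.1 (trace_mul_nonneg hA hB)).1

/-- Self-duality of the positive semidefinite cone, tested on rank-one matrices. It transfers
positivity from `Φ` to its trace-dual. -/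
theorem posSemidef_of_trace_mul_nonneg {M : Matrix n n ℂ}
    (h : ∀ X : Matrix n n ℂ, X.PosSemidef → 0 ≤ (X * M).trace) : M.PosSemidef := by
  have hq (x : n → ℂ) : 0 ≤ star x ⬝ᵥ M *ᵥ x := by
    have := h _ (posSemidef_vecMulVec_self_star x)
    rwa [vecMulVec_mul, trace_vecMulVec, dotProduct_comm, ← dotProduct_mulVec] at this
  refine .of_dotProduct_mulVec_nonneg ?_ hq
  -- Over ℂ, a real-valued quadratic form forces the matrix to be Hermitian.
  rw [← isSymmetric_toEuclideanLin_iff, LinearMap.isSymmetric_iff_inner_map_self_real]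
  intro v
  have h2 := Complex.conj_eq_iff_im.2 (Complex.nonneg_iff.1 (hq v.ofLp)).2.symm
  have h3 := star_dotProduct (M *ᵥ v.ofLp) v.ofLp
  rw [Complex.star_def, h2] at h3
  simp only [EuclideanSpace.inner_eq_star_dotProduct, dotProduct_comm v.ofLp]
  rw [starRingEnd_apply]
  change star (star (M *ᵥ v.ofLp) ⬝ᵥ v.ofLp) = star (M *ᵥ v.ofLp) ⬝ᵥ v.ofLp
  rw [h3]
  exact h2

/-- Spectral decomposition of a Hermitian matrix and of the exponentials of its multiples. -/
theorem exists_spectral_decomposition {K : Matrix n n ℂ} (hK : K.IsHermitian) :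
    ∃ (k : n → ℝ) (P : n → Matrix n n ℂ), (∀ i, (P i).PosSemidef) ∧ ∑ i, P i = 1 ∧
      K = ∑ i, (k i : ℂ) • P i ∧
      (∀ t : ℝ, NormedSpace.exp ((t : ℂ) • K) = ∑ i, ((Real.exp (t * k i) : ℝ) : ℂ) • P i) ∧
      NormedSpace.exp K * K = ∑ i, ((Real.exp (k i) * k i : ℝ) : ℂ) • P i := by
  set U : Matrix n n ℂ := (hK.eigenvectorUnitary : Matrix n n ℂ)
  have h1 : U * Uᴴ = 1 := Unitary.coe_mul_star_self hK.eigenvectorUnitary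
  have hu : IsUnit U := ⟨⟨U, Uᴴ, h1, mul_eq_one_comm.1 h1⟩, rfl⟩
  have hinv : U⁻¹ = Uᴴ := Matrix.inv_eq_right_inv h1
  have key (d : n → ℂ) : U * diagonal d * Uᴴ = ∑ i, d i • (U * single i i 1 * Uᴴ) := by
    have : diagonal d = ∑ i, d i • single i i (1 : ℂ) := by
      ext a b
      simp only [Matrix.sum_apply, diagonal_apply, Matrix.smul_apply, single_apply, smul_eq_mul, mul_ite,
        mul_one, mul_zero, ite_and, Finset.sum_ite_eq', Finset.mem_univ, if_true]
    rw [this, Finset.mul_sum, Finset.sum_mul]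
    simp only [mul_smul_comm, smul_mul_assoc]
  have hs : K = U * diagonal (fun i => (hK.eigenvalues i : ℂ)) * Uᴴ := hK.spectral_theorem
  have hexp (t : ℝ) : NormedSpace.exp ((t : ℂ) • K) =
      U * diagonal (fun i => ((Real.exp (t * hK.eigenvalues i) : ℝ) : ℂ)) * Uᴴ := by
    conv_lhs => rw [hs, ← hinv, ← smul_mul_assoc, ← mul_smul_comm, exp_conj _ _ hu, ← diagonal_smul,
      exp_diagonal, hinv]
    congr 3
    ext i
    simp [Pi.coe_exp, Complex.exp_eq_exp_ℂ]
  refine ⟨hK.eigenvalues, fun i => U * single i i 1 * Uᴴ, fun i => ?_, ?_, ?_, fun t => ?_, ?_⟩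
  · refine PosSemidef.mul_mul_conjTranspose_same ?_ U
    rw [← diagonal_single]
    exact .diagonal (Pi.single_nonneg.2 zero_le_one)
  · simpa [h1] using (key 1).symm
  · rw [← key]; exact hs
  · rw [← key]; exact hexp t
  · rw [← key]
    have h := hexp 1
    rw [Complex.ofReal_one, one_smul] at h
    refine (congrArg₂ (· * ·) h hs).trans ?_
    have hc : Uᴴ * U = 1 := mul_eq_one_comm.1 h1
    rw [show ∀ D D' : Matrix n n ℂ, U * D * Uᴴ * (U * D' * Uᴴ) = U * (D * (Uᴴ * U) * D') * Uᴴ from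
      fun D D' => by simp only [mul_assoc], hc, mul_one, diagonal_mul_diagonal]
    simp

theorem exp_half_mul_self (K : Matrix n n ℂ) :
    NormedSpace.exp ((2⁻¹ : ℂ) • K) * NormedSpace.exp ((2⁻¹ : ℂ) • K) = NormedSpace.exp K := by
  rw [← exp_add_of_commute _ _ (Commute.refl _), ← add_smul]
  norm_num

omit [Fintype n] [DecidableEq n] in
theorem isHermitian_half_smul {K : Matrix n n ℂ} (hK : K.IsHermitian) :
    ((2⁻¹ : ℂ) • K).IsHermitian := by
  rw [IsHermitian, conjTranspose_smul, hK.eq]; simp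

theorem posDef_exp {K : Matrix n n ℂ} (hK : K.IsHermitian) : (NormedSpace.exp K).PosDef := by
  have h : NormedSpace.exp K =
      NormedSpace.exp ((2⁻¹ : ℂ) • K) * (NormedSpace.exp ((2⁻¹ : ℂ) • K))ᴴ := by
    rw [(isHermitian_half_smul hK).exp.eq, exp_half_mul_self]
  have hp : (NormedSpace.exp K).PosSemidef := h ▸ posSemidef_self_mul_conjTranspose _
  exact hp.posDef_iff_isUnit.2 (isUnit_exp K)

theorem sqrt_exp {K : Matrix n n ℂ} (hK : K.IsHermitian) :
    CFC.sqrt (NormedSpace.exp K) = NormedSpace.exp ((2⁻¹ : ℂ) • K) :=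
  CFC.sqrt_unique (exp_half_mul_self K) (posDef_exp (isHermitian_half_smul hK)).posSemidef.nonneg

/-! ### Operator monotone square root, polar decomposition and fidelity -/

section Norm
open scoped Matrix.Norms.L2Operator

theorem le_sqrt_of_mul_self_le {T M : Matrix n n ℂ} (hT : 0 ≤ T) (h : T * T ≤ M) :
    T ≤ CFC.sqrt M := by
  have := CFC.sqrt_le_sqrt _ _ h
  rwa [CFC.sqrt_mul_self T hT] at this

end Norm

/-- Polar decomposition of an invertible matrix. -/
theorem exists_polar {A : Matrix n n ℂ} (hA : IsUnit A) :
    (CFC.abs A).PosDef ∧ ∃ V : Matrix n n ℂ, Vᴴ * V = 1 ∧ V * CFC.abs A = A := by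
  have hsq : CFC.abs A * CFC.abs A = Aᴴ * A := CFC.abs_mul_abs A
  have hp : (CFC.abs A).PosSemidef := (CFC.abs_nonneg A).posSemidef
  have hu : IsUnit (CFC.abs A) := by
    have : IsUnit (CFC.abs A * CFC.abs A) := hsq ▸ (hA.star.mul hA)
    exact isUnit_of_mul_isUnit_left this
  have hd : IsUnit (CFC.abs A).det := (isUnit_iff_isUnit_det _).1 hu
  refine ⟨hp.posDef_iff_isUnit.2 hu, A * (CFC.abs A)⁻¹, ?_, ?_⟩
  · rw [conjTranspose_mul, conjTranspose_nonsing_inv, hp.isHermitian.eq, mul_assoc,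
      ← mul_assoc Aᴴ, ← hsq, mul_assoc, mul_nonsing_inv _ hd, mul_one, nonsing_inv_mul _ hd]
  · rw [mul_assoc, nonsing_inv_mul _ hd, mul_one]

omit [DecidableEq n] in
theorem re_trace_conjTranspose (A : Matrix n n ℂ) : Aᴴ.trace.re = A.trace.re := by
  rw [trace_conjTranspose]; simp

/-- With A = V|A| and V unitary, the nonnegative number Tr (1 - V)*(1 - V)|A| expands to 2(Tr |A| -
Re Tr A). -/
theorem re_trace_le_traceNorm {A : Matrix n n ℂ} (hA : IsUnit A) : A.trace.re ≤ traceNorm A := by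
  obtain ⟨hB, V, hV, hVA⟩ := exists_polar hA
  have h := re_trace_mul_nonneg (posSemidef_conjTranspose_mul_self (1 - V)) hB.posSemidef
  have e : (1 - V)ᴴ * (1 - V) * CFC.abs A = CFC.abs A + CFC.abs A - A - Vᴴ * CFC.abs A := by
    rw [conjTranspose_sub, conjTranspose_one]
    have : (1 - Vᴴ) * (1 - V) = 1 + Vᴴ * V - V - Vᴴ := by noncomm_ring
    rw [this, hV]
    simp only [sub_mul, add_mul, one_mul, hVA]
  have e2 : (Vᴴ * CFC.abs A).trace.re = A.trace.re := by
    rw [← re_trace_conjTranspose, conjTranspose_mul, conjTranspose_conjTranspose,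
      hB.isHermitian.eq, trace_mul_comm, hVA]
  rw [e, trace_sub, trace_sub, trace_add] at h
  simp only [Complex.sub_re, Complex.add_re, e2] at h
  rw [traceNorm]
  linarith

theorem isUnit_sqrt_mul_sqrt {ρ σ : Matrix n n ℂ} (hρ : ρ.PosDef) (hσ : σ.PosDef) :
    IsUnit (CFC.sqrt ρ * CFC.sqrt σ) := by
  have h {τ : Matrix n n ℂ} (hτ : τ.PosDef) : IsUnit (CFC.sqrt τ) := by
    have := hτ.isUnit
    rw [← CFC.sqrt_mul_sqrt_self τ hτ.posSemidef.nonneg] at this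
    exact isUnit_of_mul_isUnit_left this
  exact (h hρ).mul (h hσ)

theorem re_trace_sqrt_mul_sqrt_le_fidelity {ρ σ : Matrix n n ℂ} (hρ : ρ.PosDef) (hσ : σ.PosDef) :
    (CFC.sqrt ρ * CFC.sqrt σ).trace.re ≤ fidelity ρ σ :=
  re_trace_le_traceNorm (isUnit_sqrt_mul_sqrt hρ hσ)

theorem fidelity_pos [Nonempty n] {ρ σ : Matrix n n ℂ} (hρ : ρ.PosDef) (hσ : σ.PosDef) :
    0 < fidelity ρ σ :=
  (Complex.pos_iff.1 (exists_polar (isUnit_sqrt_mul_sqrt hρ hσ)).1.trace_pos).1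

/-- Taking `V` from the polar decomposition of √ρ√σ turns the cross term of the squared
Hilbert–Schmidt distance into the fidelity. Both F ≤ 1 and its equality case can be read off. -/
theorem exists_fidelity_eq {ρ σ : Matrix n n ℂ} (hρ : ρ.PosDef) (hσ : σ.PosDef)
    (hρ1 : ρ.trace = 1) (hσ1 : σ.trace = 1) :
    ∃ V : Matrix n n ℂ, Vᴴ * V = 1 ∧
      (((CFC.sqrt ρ * V - CFC.sqrt σ)ᴴ * (CFC.sqrt ρ * V - CFC.sqrt σ)).trace).re =
        2 - 2 * fidelity ρ σ := by
  obtain ⟨hB, V, hV, hVA⟩ := exists_polar (isUnit_sqrt_mul_sqrt hρ hσ)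
  have hr : (CFC.sqrt ρ)ᴴ = CFC.sqrt ρ := (CFC.sqrt_nonneg ρ).posSemidef.isHermitian.eq
  have hs : (CFC.sqrt σ)ᴴ = CFC.sqrt σ := (CFC.sqrt_nonneg σ).posSemidef.isHermitian.eq
  have hr2 := CFC.sqrt_mul_sqrt_self ρ hρ.posSemidef.nonneg
  have hs2 := CFC.sqrt_mul_sqrt_self σ hσ.posSemidef.nonneg
  have hV' : V * Vᴴ = 1 := mul_eq_one_comm.1 hV
  have hAV : Vᴴ * (CFC.sqrt ρ * CFC.sqrt σ) = CFC.abs (CFC.sqrt ρ * CFC.sqrt σ) := by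
    conv_lhs => rw [← hVA, ← mul_assoc, hV, one_mul]
  refine ⟨V, hV, ?_⟩
  have e1 : (CFC.sqrt ρ * V - CFC.sqrt σ)ᴴ * (CFC.sqrt ρ * V - CFC.sqrt σ) =
      Vᴴ * (CFC.sqrt ρ * CFC.sqrt ρ) * V + CFC.sqrt σ * CFC.sqrt σ
        - Vᴴ * (CFC.sqrt ρ * CFC.sqrt σ) - (Vᴴ * (CFC.sqrt ρ * CFC.sqrt σ))ᴴ := by
    simp only [conjTranspose_sub, conjTranspose_mul, conjTranspose_conjTranspose, hr, hs]
    noncomm_ring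
  have e2 : (Vᴴ * ρ * V).trace = 1 := by
    rw [trace_mul_comm, ← mul_assoc, hV', one_mul, hρ1]
  rw [e1, hr2, hs2, trace_sub, trace_sub, trace_add, Complex.sub_re, re_trace_conjTranspose, hAV,
    e2, hσ1, fidelity, traceNorm, Complex.sub_re, Complex.add_re, Complex.one_re]
  ring

theorem fidelity_le_one {ρ σ : Matrix n n ℂ} (hρ : ρ.PosDef) (hσ : σ.PosDef)
    (hρ1 : ρ.trace = 1) (hσ1 : σ.trace = 1) : fidelity ρ σ ≤ 1 := by
  obtain ⟨V, -, h⟩ := exists_fidelity_eq hρ hσ hρ1 hσ1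
  have := (Complex.nonneg_iff.1 (posSemidef_conjTranspose_mul_self
    (CFC.sqrt ρ * V - CFC.sqrt σ)).trace_nonneg).1
  linarith

theorem eq_of_fidelity_eq_one {ρ σ : Matrix n n ℂ} (hρ : ρ.PosDef) (hσ : σ.PosDef)
    (hρ1 : ρ.trace = 1) (hσ1 : σ.trace = 1) (h1 : fidelity ρ σ = 1) : σ = ρ := by
  obtain ⟨V, hV, h⟩ := exists_fidelity_eq hρ hσ hρ1 hσ1
  have h0 := Complex.nonneg_iff.1 (posSemidef_conjTranspose_mul_self
    (CFC.sqrt ρ * V - CFC.sqrt σ)).trace_nonneg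
  have hz : ((CFC.sqrt ρ * V - CFC.sqrt σ)ᴴ * (CFC.sqrt ρ * V - CFC.sqrt σ)).trace = 0 :=
    Complex.ext (by rw [h, h1]; norm_num) h0.2.symm
  have he : CFC.sqrt σ = CFC.sqrt ρ * V :=
    (sub_eq_zero.1 (trace_conjTranspose_mul_self_eq_zero_iff.1 hz)).symm
  have hr : (CFC.sqrt ρ)ᴴ = CFC.sqrt ρ := (CFC.sqrt_nonneg ρ).posSemidef.isHermitian.eq
  have hs : (CFC.sqrt σ)ᴴ = CFC.sqrt σ := (CFC.sqrt_nonneg σ).posSemidef.isHermitian.eq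
  calc σ = CFC.sqrt σ * (CFC.sqrt σ)ᴴ := by
        rw [hs, CFC.sqrt_mul_sqrt_self σ hσ.posSemidef.nonneg]
    _ = CFC.sqrt ρ * (V * Vᴴ) * CFC.sqrt ρ := by
        rw [he, conjTranspose_mul, hr]; simp only [mul_assoc]
    _ = ρ := by
        rw [mul_eq_one_comm.1 hV, mul_one, CFC.sqrt_mul_sqrt_self ρ hρ.posSemidef.nonneg]

/-! ### Unital positive maps: Kadison and Jensen inequalities -/

/-- Kadison's inequality for a positive operator-valued measure. -/
theorem sum_smul_mul_self_le {ι : Type*} [Fintype ι] (a : ι → ℝ) {E : ι → Matrix n n ℂ}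
    (hE : ∀ i, (E i).PosSemidef) (h1 : ∑ i, E i = 1) :
    (∑ i, (a i : ℂ) • E i) * (∑ i, (a i : ℂ) • E i) ≤ ∑ i, ((a i ^ 2 : ℝ) : ℂ) • E i := by
  set T := ∑ i, (a i : ℂ) • E i with hT
  have hTh : Tᴴ = T := by
    simp [hT, conjTranspose_sum, conjTranspose_smul, fun i => (hE i).isHermitian.eq]
  rw [Matrix.le_iff]
  -- The operator analogue of variance as the mean squared deviation from the mean `T`.
  have e : ∑ i, ((a i ^ 2 : ℝ) : ℂ) • E i - T * T =
      ∑ i, ((a i : ℂ) • 1 - T)ᴴ * E i * ((a i : ℂ) • 1 - T) := by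
    have (i : ι) : ((a i : ℂ) • 1 - T)ᴴ * E i * ((a i : ℂ) • 1 - T) =
        ((a i ^ 2 : ℝ) : ℂ) • E i - ((a i : ℂ) • E i) * T - T * ((a i : ℂ) • E i) + T * E i * T := by
      rw [conjTranspose_sub, conjTranspose_smul, hTh]
      simp only [Complex.star_def, Complex.conj_ofReal, conjTranspose_one, sub_mul, mul_sub, smul_mul_assoc,
        mul_smul_comm, one_mul, mul_one, Complex.ofReal_mul, pow_two, smul_smul, smul_sub]
      abel
    simp_rw [this, Finset.sum_add_distrib, Finset.sum_sub_distrib, ← Finset.sum_mul,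
      ← Finset.mul_sum, ← hT, h1]
    noncomm_ring
  rw [e]
  exact posSemidef_sum _ fun i _ => (hE i).conjTranspose_mul_mul_same _

theorem exp_sum_le_sum_mul_exp {ι : Type*} [Fintype ι] {w : ι → ℝ} (x : ι → ℝ)
    (hw : ∀ i, 0 ≤ w i) (h1 : ∑ i, w i = 1) :
    Real.exp (∑ i, w i * x i) ≤ ∑ i, w i * Real.exp (x i) := by
  simpa using convexOn_exp.map_sum_le (t := Finset.univ) (w := w) (p := x)
    (fun i _ => hw i) h1 (by simp)

theorem posSemidef_traceDual (Φ : Matrix n n ℂ →ₚ[ℂ] Matrix n n ℂ) {Y : Matrix n n ℂ}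
    (hY : Y.PosSemidef) : (traceDual Φ.toLinearMap Y).PosSemidef := by
  refine posSemidef_of_trace_mul_nonneg fun X hX => ?_
  rw [← trace_mul_traceDual]
  exact trace_mul_nonneg (map_nonneg Φ hX.nonneg).posSemidef hY

theorem traceDual_one {Φ : Matrix n n ℂ →ₗ[ℂ] Matrix n n ℂ} (hΦ : IsTracePreserving Φ) :
    traceDual Φ 1 = 1 := by
  refine ext_iff_trace_mul_left.mpr fun X => ?_
  rw [← trace_mul_traceDual, mul_one, mul_one, hΦ]

variable {N : Matrix n n ℂ →ₗ[ℂ] Matrix n n ℂ}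

/-- The exponential dominates c·1 for some c > 0, and a unital positive map preserves this lower
bound. -/
theorem posDef_map_exp (hN : ∀ Y : Matrix n n ℂ, Y.PosSemidef → (N Y).PosSemidef) (h1 : N 1 = 1)
    {K : Matrix n n ℂ} (hK : K.IsHermitian) : (N (NormedSpace.exp K)).PosDef := by
  obtain ⟨k, P, hP, hP1, -, hexp, -⟩ := exists_spectral_decomposition hK
  have he := hexp 1
  simp only [Complex.ofReal_one, one_smul, one_mul] at he
  set c : ℝ := Real.exp (-‖k‖)
  have hc : 0 < c := Real.exp_pos _
  have e : NormedSpace.exp K = (c : ℂ) • 1 + ∑ i, ((Real.exp (k i) - c : ℝ) : ℂ) • P i := by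
    rw [he, ← hP1, Finset.smul_sum, ← Finset.sum_add_distrib]
    refine Finset.sum_congr rfl fun i _ => ?_
    rw [← add_smul]
    simp
  rw [e, map_add, map_smul, h1]
  refine (PosDef.one.smul (Complex.zero_lt_real.2 hc)).add_posSemidef (hN _ ?_)
  refine posSemidef_sum _ fun i _ => (hP i).smul (Complex.zero_le_real.2 (sub_nonneg.2 ?_))
  exact Real.exp_le_exp.2 (abs_le.1 (norm_le_pi_norm k i)).1

/-- The images N(P i) of the spectral projections of `K` form a positive operator-valued measure, so
Kadison's inequality applies with values e^{k i / 2}. -/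
theorem map_exp_half_mul_self_le (hN : ∀ Y : Matrix n n ℂ, Y.PosSemidef → (N Y).PosSemidef)
    (h1 : N 1 = 1) {K : Matrix n n ℂ} (hK : K.IsHermitian) :
    N (NormedSpace.exp ((2⁻¹ : ℂ) • K)) * N (NormedSpace.exp ((2⁻¹ : ℂ) • K)) ≤
      N (NormedSpace.exp K) := by
  obtain ⟨k, P, hP, hP1, -, hexp, -⟩ := exists_spectral_decomposition hK
  have he := hexp 1
  have he2 := hexp 2⁻¹
  simp only [Complex.ofReal_one, one_smul, one_mul] at he
  rw [Complex.ofReal_inv, Complex.ofReal_ofNat] at he2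
  rw [he, he2]
  simp only [map_sum, map_smul]
  convert sum_smul_mul_self_le (fun i => Real.exp (2⁻¹ * k i)) (fun i => hN _ (hP i))
    (by rw [← map_sum, hP1, h1]) using 4 with i
  rw [← Real.exp_nat_mul]
  congr 1
  push_cast
  ring

/-- The numbers e^{l j} Tr(Q j N(P i)) form a probability distribution on pairs (j, i). Jensen's
inequality for exp applied to (k i - l j)/2 is the claim: the factor e^{-l j / 2} turns the weight
e^{l j} into e^{l j / 2}. -/
theorem exp_half_le_re_trace (hN : ∀ Y : Matrix n n ℂ, Y.PosSemidef → (N Y).PosSemidef)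
    (h1 : N 1 = 1) {L K : Matrix n n ℂ} (hL : L.IsHermitian) (hK : K.IsHermitian)
    (ht : (NormedSpace.exp L).trace = 1) :
    Real.exp (2⁻¹ * ((NormedSpace.exp L * N K).trace.re - (NormedSpace.exp L * L).trace.re)) ≤
      (NormedSpace.exp ((2⁻¹ : ℂ) • L) * N (NormedSpace.exp ((2⁻¹ : ℂ) • K))).trace.re := by
  obtain ⟨k, P, hP, hP1, hKP, hKe, -⟩ := exists_spectral_decomposition hK
  obtain ⟨l, Q, hQ, -, -, hLe, hLL⟩ := exists_spectral_decomposition hL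
  have hLe1 := hLe 1
  have hLe2 := hLe 2⁻¹
  have hKe2 := hKe 2⁻¹
  simp only [Complex.ofReal_one, one_smul, one_mul] at hLe1
  rw [Complex.ofReal_inv, Complex.ofReal_ofNat] at hLe2 hKe2
  set c : n × n → ℝ := fun x => (Q x.1 * N (P x.2)).trace.re
  have hc (x : n × n) : 0 ≤ c x := re_trace_mul_nonneg (hQ _) (hN _ (hP _))
  have key (a b : n → ℝ) : ((∑ j, (a j : ℂ) • Q j) * N (∑ i, (b i : ℂ) • P i)).trace.re =
      ∑ x : n × n, a x.1 * b x.2 * c x := by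
    simp only [map_sum, map_smul, Finset.sum_mul_sum, trace_sum, smul_mul_smul_comm, trace_smul,
      Complex.re_sum, Fintype.sum_prod_type, smul_eq_mul, ← Complex.ofReal_mul,
      Complex.re_ofReal_mul, c]
  -- Taking b = 1 in `key` sums out the index of `K`; this yields the normalisation and Tr e^L L.
  have hone : N (∑ i, (((fun _ => 1 : n → ℝ) i : ℝ) : ℂ) • P i) = 1 := by simp [hP1, h1]
  have ew : ∑ x : n × n, Real.exp (l x.1) * c x = 1 := by
    have := key (fun j => Real.exp (l j)) fun _ => 1
    rw [hone, ← hLe1, mul_one, ht] at this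
    simpa using this.symm
  have eK := key (fun j => Real.exp (l j)) k
  rw [← hLe1, ← hKP] at eK
  have eL := key (fun j => Real.exp (l j) * l j) fun _ => 1
  rw [hone, ← hLL, mul_one] at eL
  have eH := key (fun j => Real.exp (2⁻¹ * l j)) fun i => Real.exp (2⁻¹ * k i)
  rw [← hLe2, ← hKe2] at eH
  rw [eK, eL, eH]
  have := exp_sum_le_sum_mul_exp (w := fun x : n × n => Real.exp (l x.1) * c x)
    (fun x => 2⁻¹ * (k x.2 - l x.1)) (fun x => mul_nonneg (Real.exp_pos _).le (hc x)) ew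
  convert this using 1
  · rw [← Finset.sum_sub_distrib, Finset.mul_sum]
    congr 1
    exact Finset.sum_congr rfl fun x _ => by ring
  · refine Finset.sum_congr rfl fun x _ => ?_
    rw [mul_right_comm (Real.exp (l x.1)), ← Real.exp_add, ← Real.exp_add]
    congr 2
    ring

/-! ### Gibbs states and assembly of the bound -/

variable (β : ℝ) {H : Matrix n n ℂ}

theorem isHermitian_gibbs_exponent (hH : H.IsHermitian) :
    ((β : ℂ) • (((freeEnergy β H : ℝ) : ℂ) • (1 : Matrix n n ℂ) - H)).IsHermitian := by
  rw [IsHermitian, conjTranspose_smul, conjTranspose_sub, conjTranspose_smul, hH.eq]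
  simp

theorem posDef_gibbs (hH : H.IsHermitian) : (gibbs β H).PosDef :=
  posDef_exp (isHermitian_gibbs_exponent β hH)

theorem trace_gibbs [Nonempty n] {β : ℝ} (hβ : β ≠ 0) (hH : H.IsHermitian) :
    (gibbs β H).trace = 1 := by
  have hH' : (-(β : ℂ) • H).IsHermitian := by
    rw [IsHermitian, conjTranspose_smul, hH.eq]; simp
  have hZ := Complex.pos_iff.1 (posDef_exp hH').trace_pos
  set Z := (NormedSpace.exp (-(β : ℂ) • H)).trace with hZd
  have hZr : Z = (Z.re : ℂ) := Complex.ext rfl (by simp [← hZ.2])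
  have e : (β : ℂ) • (((freeEnergy β H : ℝ) : ℂ) • (1 : Matrix n n ℂ) - H) =
      diagonal (fun _ => ((β * freeEnergy β H : ℝ) : ℂ)) + -(β : ℂ) • H := by
    rw [← smul_one_eq_diagonal, smul_sub, smul_smul, Complex.ofReal_mul, neg_smul,
      sub_eq_add_neg]
  have hF : β * freeEnergy β H = -Real.log Z.re := by
    rw [freeEnergy, ← hZd]; field_simp
  have hcomm : Commute (diagonal fun _ : n => ((β * freeEnergy β H : ℝ) : ℂ)) (-(β : ℂ) • H) := by
    rw [← smul_one_eq_diagonal]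
    exact (Commute.one_left _).smul_left _
  have hd : NormedSpace.exp (fun _ : n => ((β * freeEnergy β H : ℝ) : ℂ)) =
      fun _ => ((Z.re⁻¹ : ℝ) : ℂ) := by
    ext i
    rw [Pi.coe_exp, ← Complex.exp_eq_exp_ℂ, hF, ← Complex.ofReal_exp, Real.exp_neg,
      Real.exp_log hZ.1]
  rw [gibbs, e, exp_add_of_commute _ _ hcomm, exp_diagonal, hd, ← smul_one_eq_diagonal,
    smul_mul_assoc, one_mul, trace_smul, ← hZd, smul_eq_mul]
  nth_rw 2 [hZr]
  rw [← Complex.ofReal_mul, inv_mul_cancel₀ hZ.1.ne', Complex.ofReal_one]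

/-- Each Hamiltonian is traded for the logarithm of its Gibbs state. The free energies come out as
bare constants because both Γ₀ and Φ(Γ₀) have trace one. -/
theorem mul_energyChange_sub [Nonempty n] {β : ℝ} (hβ : β ≠ 0) {H₀ Hτ : Matrix n n ℂ}
    (hH₀ : H₀.IsHermitian) {Φ : Matrix n n ℂ →ₗ[ℂ] Matrix n n ℂ} (hΦ : IsTracePreserving Φ) :
    β * (energyChange Φ (gibbs β H₀) H₀ Hτ - (freeEnergy β Hτ - freeEnergy β H₀)) =
      (gibbs β H₀ * ((β : ℂ) • (((freeEnergy β H₀ : ℝ) : ℂ) • (1 : Matrix n n ℂ) - H₀))).trace.re -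
      (gibbs β H₀ * traceDual Φ
        ((β : ℂ) • (((freeEnergy β Hτ : ℝ) : ℂ) • (1 : Matrix n n ℂ) - Hτ))).trace.re := by
  have h1 := trace_gibbs hβ hH₀
  rw [← trace_mul_traceDual]
  simp only [mul_smul_comm, mul_sub, trace_smul, trace_sub, mul_one, hΦ (gibbs β H₀), h1,
    smul_eq_mul, ← Complex.ofReal_mul, Complex.sub_re, Complex.re_ofReal_mul, Complex.ofReal_re,
    energyChange]
  ring

omit [DecidableEq n] in
theorem trace_inv_trace_smul {M : Matrix n n ℂ} (hM : M.trace ≠ 0) :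
    (M.trace⁻¹ • M).trace = 1 := by
  rw [trace_smul, smul_eq_mul, inv_mul_cancel₀ hM]

theorem neg_two_mul_log_fidelity_le [Nonempty n]
    (hN : ∀ Y : Matrix n n ℂ, Y.PosSemidef → (N Y).PosSemidef)
    (h1 : N 1 = 1) {L K : Matrix n n ℂ} (hL : L.IsHermitian) (hK : K.IsHermitian)
    (ht : (NormedSpace.exp L).trace = 1) {c : ℝ} (hc : 0 < c) :
    -2 * Real.log (fidelity (NormedSpace.exp L) ((c : ℂ)⁻¹ • N (NormedSpace.exp K))) -
      Real.log c ≤ (NormedSpace.exp L * L).trace.re - (NormedSpace.exp L * N K).trace.re := by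
  set T := N (NormedSpace.exp ((2⁻¹ : ℂ) • K))
  set M := N (NormedSpace.exp K)
  have hT : T.PosSemidef := hN _ (posDef_exp (isHermitian_half_smul hK)).posSemidef
  have hcC : (0 : ℂ) < (c : ℂ)⁻¹ := by
    rw [← Complex.ofReal_inv]; exact Complex.zero_lt_real.2 (inv_pos.2 hc)
  have hγ : ((c : ℂ)⁻¹ • M).PosDef := (posDef_map_exp hN h1 hK).smul hcC
  -- Normalising γ by 1/c scales its square root by c^{-1/2}; after taking logarithms and doubling,
  -- this produces the term -ln c.
  set s : ℝ := (Real.sqrt c)⁻¹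
  have hs : 0 < s := inv_pos.2 (Real.sqrt_pos.2 hc)
  have hss : (s : ℂ) * s = (c : ℂ)⁻¹ := by
    rw [← Complex.ofReal_mul, ← Complex.ofReal_inv, ← mul_inv, Real.mul_self_sqrt hc.le]
  have hle : (s : ℂ) • T ≤ CFC.sqrt ((c : ℂ)⁻¹ • M) := by
    refine le_sqrt_of_mul_self_le (hT.smul (Complex.zero_le_real.2 hs.le)).nonneg ?_
    rw [smul_mul_smul_comm, hss, Matrix.le_iff, ← smul_sub]
    exact (Matrix.le_iff.1 (map_exp_half_mul_self_le hN h1 hK)).smul hcC.le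
  have hρ := posDef_exp hL
  have h2 := re_trace_mul_nonneg (posDef_exp (isHermitian_half_smul hL)).posSemidef
    (Matrix.le_iff.1 hle)
  rw [mul_sub, trace_sub, Complex.sub_re, mul_smul_comm, trace_smul, smul_eq_mul,
    Complex.re_ofReal_mul] at h2
  have h3 := re_trace_sqrt_mul_sqrt_le_fidelity hρ hγ
  rw [sqrt_exp hL] at h3
  have h4 := exp_half_le_re_trace hN h1 hL hK ht
  have h5 := (mul_le_mul_of_nonneg_left h4 hs.le).trans ((sub_nonneg.1 h2).trans h3)
  have h6 := Real.log_le_log (by positivity) h5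
  rw [Real.log_mul hs.ne' (Real.exp_pos _).ne', Real.log_exp, Real.log_inv,
    Real.log_sqrt hc.le] at h6
  linarith

end

end ThermoReverse

open ThermoReverse ComplexOrder in
theorem mainTheorem3 {n : Type*} [Fintype n] [DecidableEq n] [Nonempty n]
    (β : ℝ) (hβ : 0 < β)
    (H₀ Hτ : Matrix n n ℂ) (hH₀ : H₀.IsHermitian) (hHτ : Hτ.IsHermitian)
    (Φ : Matrix n n ℂ →ₚ[ℂ] Matrix n n ℂ)
    (hΦ : ThermoReverse.IsTracePreserving Φ.toLinearMap) :
    -- the logarithms below are taken of positive numbers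
    0 < ThermoReverse.dualTrace β Φ.toLinearMap Hτ ∧
    0 < ThermoReverse.fidelity (ThermoReverse.gibbs β H₀)
      (ThermoReverse.retrodicted β Φ.toLinearMap Hτ) ∧
    -- the bound
    β * (ThermoReverse.energyChange Φ.toLinearMap (ThermoReverse.gibbs β H₀) H₀ Hτ -
        (ThermoReverse.freeEnergy β Hτ - ThermoReverse.freeEnergy β H₀)) ≥
      -2 * Real.log (ThermoReverse.fidelity (ThermoReverse.gibbs β H₀)
          (ThermoReverse.retrodicted β Φ.toLinearMap Hτ)) -
        Real.log (ThermoReverse.dualTrace β Φ.toLinearMap Hτ) ∧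
    -- it is tighter than the bound through the Bures angle, strictly so unless `γ = Γ₀`
    -2 * Real.log (ThermoReverse.fidelity (ThermoReverse.gibbs β H₀)
          (ThermoReverse.retrodicted β Φ.toLinearMap Hτ)) -
        Real.log (ThermoReverse.dualTrace β Φ.toLinearMap Hτ) ≥
      8 / Real.pi ^ 2 * ThermoReverse.buresAngle (ThermoReverse.gibbs β H₀)
          (ThermoReverse.retrodicted β Φ.toLinearMap Hτ) ^ 2 -
        Real.log (ThermoReverse.dualTrace β Φ.toLinearMap Hτ) ∧
    (ThermoReverse.retrodicted β Φ.toLinearMap Hτ ≠ ThermoReverse.gibbs β H₀ →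
      -2 * Real.log (ThermoReverse.fidelity (ThermoReverse.gibbs β H₀)
            (ThermoReverse.retrodicted β Φ.toLinearMap Hτ)) -
          Real.log (ThermoReverse.dualTrace β Φ.toLinearMap Hτ) >
        8 / Real.pi ^ 2 * ThermoReverse.buresAngle (ThermoReverse.gibbs β H₀)
            (ThermoReverse.retrodicted β Φ.toLinearMap Hτ) ^ 2 -
          Real.log (ThermoReverse.dualTrace β Φ.toLinearMap Hτ)) := by
  have hN (Y : Matrix n n ℂ) (hY : Y.PosSemidef) := posSemidef_traceDual Φ hY
  have h1 := traceDual_one hΦ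
  have hL := isHermitian_gibbs_exponent β hH₀
  have hK := isHermitian_gibbs_exponent β hHτ
  have hρ : (gibbs β H₀).PosDef := posDef_gibbs β hH₀
  have hρ1 := trace_gibbs hβ.ne' hH₀
  have hM : (traceDual Φ.toLinearMap (gibbs β Hτ)).PosDef := posDef_map_exp hN h1 hK
  have hMt := Complex.pos_iff.1 hM.trace_pos
  have hc : 0 < dualTrace β Φ.toLinearMap Hτ := hMt.1
  have hcM : (traceDual Φ.toLinearMap (gibbs β Hτ)).trace =
      (dualTrace β Φ.toLinearMap Hτ : ℂ) := Complex.ext rfl (by simp [← hMt.2])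
  have hγ : (retrodicted β Φ.toLinearMap Hτ).PosDef := by
    refine hM.smul ?_
    rw [hcM, ← Complex.ofReal_inv]
    exact Complex.zero_lt_real.2 (inv_pos.2 hc)
  have hγ1 : (retrodicted β Φ.toLinearMap Hτ).trace = 1 :=
    trace_inv_trace_smul hM.trace_pos.ne'
  have hF := fidelity_pos hρ hγ
  have hF1 := fidelity_le_one hρ hγ hρ1 hγ1
  have hlog := arccos_sq_le_neg_two_mul_log hF hF1
  refine ⟨hc, hF, ?_, ?_, fun hne => ?_⟩
  · rw [mul_energyChange_sub hβ.ne' hH₀ hΦ, retrodicted, hcM]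
    exact neg_two_mul_log_fidelity_le hN h1 hL hK hρ1 hc
  · refine sub_le_sub_right (le_trans ?_ hlog) _
    exact mul_le_of_le_one_left (sq_nonneg _) eight_div_pi_sq_lt_one.le
  -- Distinct states have F < 1, hence a positive angle, and 8/π² < 1 then makes the inequality
  -- strict.
  · refine sub_lt_sub_right (lt_of_lt_of_le ?_ hlog) _
    refine mul_lt_of_lt_one_left (pow_pos (Real.arccos_pos.2 ?_) 2) eight_div_pi_sq_lt_one
    exact lt_of_le_of_ne hF1 fun h => hne (eq_of_fidelity_eq_one hρ hγ hρ1 hγ1 h)
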